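/- Let $\mathbb F=\mathbb R$ or $\mathbb C$ and let $\mathcal A$ be a nonzero unital $C^*$-algebra over $\mathbb F$: a unital Banach $*$-algebra over $\mathbb F$ with $\|x^*x\|=\|x\|^2$ for all $x$ and, if $\mathbb F=\mathbb R$, with $1_{\mathcal A}+x^*x$ invertible for all $x$. A state on $\mathcal A$ is an $\mathbb F$-linear functional $\phi:\mathcal A\to\mathbb F$ with $\phi(1_{\mathcal A})=1$ that takes positive elements (those of the form $y^*y$) to non-negative real numbers and, if $\mathbb F=\mathbb R$, also satisfies $\phi(x^*)=\phi(x)$ for all $x\in\mathcal A$. A cyclic representation $(\mathcal H,\pi,\xi)$ of $\mathcal A$ consists of a Hilbert space $\mathcal H$ over $\mathbb F$, a $*$-algebra homomorphism $\pi$ from $\mathcal A$ to the algebra $\mathscr B(\mathcal H)$ of bounded operators with $\pi(1_{\mathcal A})=1$, and a unit vector $\xi\in\mathcal H$ such that $\{\pi(x)\xi : x\in\mathcal A\}$ is dense in $\mathcal H$. Let $a\in\mathcal A$ and let $\mathcal B$ be an $\mathbb F$-linear subspace of $\mathcal A$. Then the following are equivalent. 1. $a$ is Birkhoff–James orthogonal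 to $\mathcal B$, that is, $\|a\|\le\|a+kb\|$ for all $b\in\mathcal B$ and all $k\in\mathbb F$. 2. There exists a state $\phi$ on $\mathcal A$ such that $\phi(a^*a)=\|a\|^2$ and $\phi(a^*b)=0$ for all $b\in\mathcal B$. 3. There exists a cyclic representation $(\mathcal H,\pi,\xi)$ of $\mathcal A$ such that $\|\pi(a)\xi\|=\|a\|$ and $\langle\pi(a)\xi\,|\,\pi(b)\xi\rangle=0$ for all $b\in\mathcal B$. -/

import Mathlib

universe u v

/-- `v` is Birkhoff-James orthogonal to `u` (over the scalar field `𝕜`). -/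
def IsBJOrthogonal (𝕜 : Type*) {V : Type*} [RCLike 𝕜] [NormedAddCommGroup V] [NormedSpace 𝕜 V]
    (v u : V) : Prop :=
  ∀ k : 𝕜, ‖v‖ ≤ ‖v + k • u‖

/-- `v` is Birkhoff-James orthogonal to the subspace `W`. -/
def IsBJOrthogonalTo {𝕜 V : Type*} [RCLike 𝕜] [NormedAddCommGroup V] [NormedSpace 𝕜 V]
    (v : V) (W : Submodule 𝕜 V) : Prop :=
  ∀ w ∈ W, IsBJOrthogonal 𝕜 v w

/-- A unital Banach *-algebra over `𝕜` (`ℝ` or `ℂ`) with the C*-identity is a unital C*-algebra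
over `𝕜` if, in the real case (where `RCLike.I = 0`), also `1 + x* x` is invertible for every `x`.
Over `ℂ` this is automatic; over `ℝ` it is part of the definition of a C*-algebra (it excludes, for
instance, `ℂ` as a real algebra with the identity as involution). -/
class IsUnitalCStarAlgebra (𝕜 A : Type*) [RCLike 𝕜] [NormedRing A] [StarRing A] [CompleteSpace A]
    [CStarRing A] [NormedAlgebra 𝕜 A] [StarModule 𝕜 A] : Prop where
  isUnit_one_add_star_mul_self :
    (RCLike.I : 𝕜) = 0 → ∀ x : A, IsUnit (1 + star x * x)

/-- The positive elements of a C*-algebra: those of the form `y* y`. -/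
def IsPositiveElement {A : Type*} [NormedRing A] [StarRing A] (x : A) : Prop :=
  ∃ y : A, x = star y * y

/-- States: linear functionals that take `1` to `1` and positive elements to non-negative real
numbers, and that in the real case (`RCLike.I = 0`) also satisfy `φ (x*) = φ x`. -/
structure IsState {𝕜 A : Type*} [RCLike 𝕜] [NormedRing A] [StarRing A] [NormedAlgebra 𝕜 A]
    (φ : A →ₗ[𝕜] 𝕜) : Prop where
  map_one : φ 1 = 1
  map_nonneg : ∀ x : A, IsPositiveElement x → ∃ r : ℝ, 0 ≤ r ∧ φ x = (r : 𝕜)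
  map_star_of_real : (RCLike.I : 𝕜) = 0 → ∀ x : A, φ (star x) = φ x

/-- `(H, π, ξ)` is a cyclic representation: `π` is a unital *-homomorphism into the bounded
operators on the Hilbert space `H` (unitality is part of `→⋆ₐ`), and `ξ` is a unit vector whose
orbit is dense in `H`. -/
structure IsCyclicRepresentation {𝕜 A H : Type*} [RCLike 𝕜] [NormedRing A] [StarRing A]
    [NormedAlgebra 𝕜 A] [NormedAddCommGroup H] [InnerProductSpace 𝕜 H] [CompleteSpace H]
    (π : A →⋆ₐ[𝕜] (H →L[𝕜] H)) (ξ : H) : Prop where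
  norm_eq_one : ‖ξ‖ = 1
  dense_orbit : Dense {η : H | ∃ x : A, η = π x ξ}

/-! The hard implication, from orthogonality to a state, is a Hahn-Banach separation over ℝ.
Positivity gives `t + ‖y‖² ≤ ‖t + y*y‖` for `t ≥ 0`. Putting `y = a + εb` with `εt` in place of `t`,
dividing by `ε` and letting `ε → 0` turns orthogonality into `t + s‖a‖² ≤ ‖t + s a*a + (a*b +
b*a)‖`. This says exactly that 0 avoids a certain open convex set, and a separating functional,
scaled to be 1 at 1, is bounded by the norm, is `‖a‖²` at `a*a` and kills every `a*b + b*a`.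
Symmetrising it under the involution and extending to `𝕜` gives the state.

The positivity input is spectral: for selfadjoint `h` one of `±‖h‖` is a spectral value. Over ℝ this
is reached by embedding the algebra isometrically in a complex Banach algebra, where the spectral
radius formula holds; invertibility of `1 + x*x` forces the spectral values found there to be real.

The state yields a representation by the GNS construction. Conversely, representations are
contractive, so Pythagoras in the Hilbert space gives `‖a‖ ≤ ‖a + kb‖`. -/

section RealCStar

/-- If `z` is not real, the right side is a positive multiple of some `1 + x²`; its invertibility
then passes to the factor `z - t`. -/
theorem algebraMap_sub_mul_algebraMap_conj_sub {E : Type*} [Ring E] [Algebra ℂ E] (z : ℂ) (t : E) :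
    (algebraMap ℂ E z - t) * (algebraMap ℂ E (starRingEnd ℂ z) - t) =
      (t - algebraMap ℂ E (z.re : ℂ)) ^ 2 + algebraMap ℂ E ((z.im ^ 2 : ℝ) : ℂ) := by
  have h1 : z = z.re + z.im * Complex.I := (Complex.re_add_im z).symm
  have h2 : starRingEnd ℂ z = z.re - z.im * Complex.I := by
    apply Complex.ext <;> simp
  have h3 : ((z.im ^ 2 : ℝ) : ℂ) = -((z.im * Complex.I) * (z.im * Complex.I)) := by
    rw [mul_mul_mul_comm, Complex.I_mul_I]; push_cast; ring
  have hr := Algebra.commutes (z.re : ℂ) t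
  have hi := Algebra.commutes (z.im * Complex.I) t
  have hri : algebraMap ℂ E (z.re : ℂ) * algebraMap ℂ E (z.im * Complex.I) =
      algebraMap ℂ E (z.im * Complex.I) * algebraMap ℂ E (z.re : ℂ) := Algebra.commutes _ _
  rw [h3, h2]
  nth_rw 1 [h1]
  rw [map_add, map_sub, map_neg, map_mul (algebraMap ℂ E) (z.im * Complex.I)]
  generalize algebraMap ℂ E (z.re : ℂ) = r at *
  generalize algebraMap ℂ E (z.im * Complex.I) = i at *
  simp only [sq, add_mul, sub_mul, mul_sub, hr, hi, hri]
  abel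

/-! ### Complex regular representation and the spectrum of a selfadjoint element -/

variable {A : Type*} [NormedRing A] [NormedAlgebra ℝ A]

/-- The bounded complex-linear operators on the complex-valued dual of a real normed algebra. -/
abbrev ComplexDualEnd (A : Type*) [NormedRing A] [NormedAlgebra ℝ A] : Type _ :=
  (A →L[ℝ] ℂ) →L[ℂ] (A →L[ℝ] ℂ)

/-- A real normed algebra acts on its complex-valued dual by right translation of functionals. -/
noncomputable def complexRegularRep (A : Type*) [NormedRing A] [NormedAlgebra ℝ A] :
    A →ₐ[ℝ] (ComplexDualEnd A) :=
  AlgHom.ofLinearMap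
    { toFun := fun a => LinearMap.mkContinuous
        { toFun := fun f => f.comp ((ContinuousLinearMap.mul ℝ A).flip a)
          map_add' := fun f g => by ext; simp
          map_smul' := fun c f => by ext; simp } ‖a‖ (fun f => by
            refine ContinuousLinearMap.opNorm_le_bound _ (by positivity) fun x => ?_
            calc ‖f (x * a)‖ ≤ ‖f‖ * ‖x * a‖ := f.le_opNorm _
              _ ≤ ‖f‖ * (‖x‖ * ‖a‖) := by gcongr; exact norm_mul_le _ _
              _ = ‖a‖ * ‖f‖ * ‖x‖ := by ring)
      map_add' := fun a b => by ext f x; simp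
      map_smul' := fun c a => by ext f x; simp }
    (by ext f x; simp)
    (fun a b => by ext f x; simp [mul_assoc])

theorem complexRegularRep_apply (a : A) (f : A →L[ℝ] ℂ) (x : A) :
    complexRegularRep A a f x = f (x * a) := rfl

theorem complexRegularRep_algebraMap (r : ℝ) :
    complexRegularRep A (algebraMap ℝ A r) =
      (algebraMap ℂ (ComplexDualEnd A) : ℂ →+* ComplexDualEnd A) (r : ℂ) := by
  ext f x
  have : x * algebraMap ℝ A r = r • x := by rw [← Algebra.commutes, Algebra.smul_def]
  rw [complexRegularRep_apply, this, map_smul, Algebra.algebraMap_eq_smul_one]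
  simp

theorem norm_complexRegularRep [NormOneClass A] (a : A) : ‖complexRegularRep A a‖ = ‖a‖ := by
  apply le_antisymm
  · refine ContinuousLinearMap.opNorm_le_bound _ (norm_nonneg _) fun f => ?_
    refine ContinuousLinearMap.opNorm_le_bound _ (by positivity) fun x => ?_
    calc ‖f (x * a)‖ ≤ ‖f‖ * ‖x * a‖ := f.le_opNorm _
      _ ≤ ‖f‖ * (‖x‖ * ‖a‖) := by gcongr; exact norm_mul_le _ _
      _ = ‖a‖ * ‖f‖ * ‖x‖ := by ring
  -- A norming functional of `a`, translated by `a` and evaluated at 1, recovers `‖a‖`.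
  · obtain ⟨g, hg, hga⟩ := exists_dual_vector'' ℝ a
    let f : A →L[ℝ] ℂ := Complex.ofRealCLM.comp g
    have hf : ‖f‖ ≤ 1 := by
      refine ContinuousLinearMap.opNorm_le_bound _ zero_le_one fun x => ?_
      simpa [f] using g.le_of_opNorm_le hg x
    calc ‖a‖ = ‖complexRegularRep A a f 1‖ := by
          simp [complexRegularRep_apply, f, hga]
      _ ≤ ‖complexRegularRep A a f‖ * ‖(1 : A)‖ := ContinuousLinearMap.le_opNorm _ _
      _ ≤ ‖complexRegularRep A a‖ * ‖f‖ * ‖(1 : A)‖ := by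
          gcongr; exact ContinuousLinearMap.le_opNorm _ _
      _ ≤ ‖complexRegularRep A a‖ := by
          rw [norm_one, mul_one]
          exact mul_le_of_le_one_right (norm_nonneg (complexRegularRep A a)) hf

/-- A real normed ring `A` with a C*-norm and `1 + x* x` always invertible, isometrically embedded in
a complex Banach algebra: `‖h‖` or `-‖h‖` is in the spectrum of a selfadjoint `h`. -/
theorem IsSelfAdjoint.not_isUnit_sub_norm_or_add_norm_of_isometry {E : Type*} [NormedRing E]
    [NormedAlgebra ℂ E] [CompleteSpace E] [Nontrivial E] [StarRing A] [CStarRing A]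
    [StarModule ℝ A] (T : A →+* E) (hT : ∀ r : ℝ, T (algebraMap ℝ A r) = algebraMap ℂ E (r : ℂ))
    (hTn : ∀ x, ‖T x‖ = ‖x‖)
    (hu : ∀ x : A, IsUnit (1 + star x * x)) {h : A} (hh : IsSelfAdjoint h) :
    ¬ IsUnit (h - algebraMap ℝ A ‖h‖) ∨ ¬ IsUnit (h + algebraMap ℝ A ‖h‖) := by
  -- Gelfand's formula along the exponents `2 ^ n`, where the C*-identity makes the sequence
  -- constant.
  have hr : spectralRadius ℂ (T h) = ‖h‖₊ := by
    have h₁ := (spectrum.pow_nnnorm_pow_one_div_tendsto_nhds_spectralRadius (T h)).comp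
      (tendsto_pow_atTop_atTop_of_one_lt one_lt_two)
    refine tendsto_nhds_unique h₁ (tendsto_const_nhds.congr fun n => ?_)
    have hn : ‖T h ^ 2 ^ n‖₊ = ‖h‖₊ ^ 2 ^ n := by
      rw [← map_pow]
      exact (NNReal.eq (hTn _)).trans (hh.nnnorm_pow_two_pow n)
    rw [Function.comp_apply, hn, ENNReal.coe_pow, ← ENNReal.rpow_natCast, ← ENNReal.rpow_mul]
    simp
  obtain ⟨z, hz, hzr⟩ := spectrum.exists_nnnorm_eq_spectralRadius (T h)
  rw [hr, ENNReal.coe_inj] at hzr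
  have hzn : ‖z‖ = ‖h‖ := congrArg NNReal.toReal hzr
  have him : z.im = 0 := by
    by_contra hne
    rw [spectrum.mem_iff] at hz
    apply hz
    have hx : IsSelfAdjoint (z.im⁻¹ • (h - algebraMap ℝ A z.re)) := by
      refine IsSelfAdjoint.smul (by simp [IsSelfAdjoint]) (hh.sub ?_)
      exact IsSelfAdjoint.algebraMap A (by simp [IsSelfAdjoint])
    have hq : IsUnit ((h - algebraMap ℝ A z.re) ^ 2 + algebraMap ℝ A (z.im ^ 2)) := by
      have h1 := hu (z.im⁻¹ • (h - algebraMap ℝ A z.re))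
      rw [hx.star_eq] at h1
      have h2 : IsUnit (algebraMap ℝ A (z.im ^ 2)) :=
        (IsUnit.mk0 (z.im ^ 2) (pow_ne_zero 2 hne)).map (algebraMap ℝ A)
      convert h2.mul h1 using 1
      rw [← Algebra.smul_def, smul_add, smul_mul_smul_comm, smul_smul, ← sq (h - _)]
      have : z.im ^ 2 * (z.im⁻¹ * z.im⁻¹) = 1 := by field_simp
      rw [this, one_smul, add_comm, Algebra.algebraMap_eq_smul_one (z.im ^ 2)]
    have hq' := hq.map T
    rw [map_add, map_pow, map_sub, hT, hT,
      ← algebraMap_sub_mul_algebraMap_conj_sub] at hq'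
    have hcomm : Commute (algebraMap ℂ E z - T h)
        (algebraMap ℂ _ (starRingEnd ℂ z) - T h) :=
      .sub_left (Algebra.commute_algebraMap_left _ _)
        ((Algebra.commute_algebraMap_right _ _).sub_right (Commute.refl _))
    exact (hcomm.isUnit_mul_iff.1 hq').1
  have hzr' : z = (z.re : ℂ) := Complex.ext rfl (by simpa using him)
  have hre : |z.re| = ‖h‖ := by rw [← hzn, hzr']; simp
  have hnu : ¬ IsUnit (h - algebraMap ℝ A z.re) := fun hun => by
    rw [spectrum.mem_iff] at hz
    apply hz
    have := hun.neg.map T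
    rw [neg_sub, map_sub, hT] at this
    rw [hzr']
    exact this
  rcases abs_choice z.re with h1 | h1
  · left; rwa [← hre, h1]
  · right
    rwa [← hre, h1, map_neg, ← sub_eq_add_neg]

variable [StarRing A] [CStarRing A] [StarModule ℝ A] [Nontrivial A]

/-- In a real C*-algebra, `‖h‖` or `-‖h‖` belongs to the spectrum of a selfadjoint `h`. -/
theorem IsSelfAdjoint.not_isUnit_sub_norm_or_add_norm
    (hu : ∀ x : A, IsUnit (1 + star x * x)) {h : A} (hh : IsSelfAdjoint h) :
    ¬ IsUnit (h - algebraMap ℝ A ‖h‖) ∨ ¬ IsUnit (h + algebraMap ℝ A ‖h‖) := by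
  have : Nontrivial (A →L[ℝ] ℂ) := by
    obtain ⟨g, -, hga⟩ := exists_dual_vector'' ℝ (1 : A)
    refine ⟨Complex.ofRealCLM.comp g, 0, fun h0 => ?_⟩
    have := DFunLike.congr_fun h0 1
    simp [hga] at this
  exact hh.not_isUnit_sub_norm_or_add_norm_of_isometry (E := ComplexDualEnd A)
    (complexRegularRep A).toRingHom (fun r => complexRegularRep_algebraMap r)
    (fun x => norm_complexRegularRep x) hu

end RealCStar

/-! ### Positivity of `y*y`: invertibility and norm estimates -/

theorem CStarAlgebra.isUnit_one_add_star_mul_self {A : Type*} [CStarAlgebra A] (x : A) :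
    IsUnit (1 + star x * x) := by
  have h : (-1 : ℝ) ∉ spectrum ℝ (star x * x) := fun hmem => by
    have := spectrum_star_mul_self_nonneg (-1) hmem
    norm_num at this
  rw [spectrum.notMem_iff] at h
  have := h.neg
  rwa [neg_sub, map_neg, map_one, sub_neg_eq_add, add_comm] at this

/-- When `𝕜` is a copy of ℂ, scalars are transported along the isomorphism to reach the complex
theorem. -/
theorem IsUnitalCStarAlgebra.isUnit (𝕜 : Type*) {A : Type*} [RCLike 𝕜] [NormedRing A] [StarRing A]
    [CompleteSpace A] [CStarRing A] [NormedAlgebra 𝕜 A] [StarModule 𝕜 A]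
    [IsUnitalCStarAlgebra 𝕜 A] (x : A) : IsUnit (1 + star x * x) := by
  rcases RCLike.I_eq_zero_or_im_I_eq_one (K := 𝕜) with h | h
  · exact isUnit_one_add_star_mul_self h x
  · let e := RCLike.complexLinearIsometryEquiv h
    let r : ℂ →+* 𝕜 := (RCLike.complexRingEquiv h).symm.toRingHom
    have hr : ∀ z, r z = (z.re : 𝕜) + (z.im : 𝕜) * RCLike.I := fun z => rfl
    let _ : Algebra ℂ A := Algebra.compHom A r
    have hsmul : ∀ (z : ℂ) (y : A), z • y = r z • y := fun z y => rfl
    let _ : NormedAlgebra ℂ A :=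
      { norm_smul_le := fun z y => by
          rw [hsmul, norm_smul]
          have : ‖r z‖ = ‖z‖ := e.symm.norm_map z
          rw [this] }
    have : StarModule ℂ A := ⟨fun z y => by
      rw [hsmul, hsmul, star_smul]
      congr 1
      simp [hr]⟩
    let _ : CStarAlgebra A := { }
    exact CStarAlgebra.isUnit_one_add_star_mul_self x

section RealCStar

theorem isUnit_add_star_mul_self {A : Type*} [NormedRing A] [NormedAlgebra ℝ A] [StarRing A]
    [StarModule ℝ A] (hu : ∀ x : A, IsUnit (1 + star x * x)) (y : A) {t : ℝ} (ht : 0 < t) :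
    IsUnit (algebraMap ℝ A t + star y * y) := by
  have h := ((IsUnit.mk0 t ht.ne').map (algebraMap ℝ A)).mul (hu ((√t)⁻¹ • y))
  convert h using 1
  have : t * ((√t)⁻¹ * (√t)⁻¹) = 1 := by
    rw [← mul_inv, Real.mul_self_sqrt ht.le, mul_inv_cancel₀ ht.ne']
  rw [mul_add, mul_one, star_smul, star_trivial (√t)⁻¹, smul_mul_smul_comm, ← Algebra.smul_def, smul_smul,
    this, one_smul]

variable {A : Type*} [NormedRing A] [NormedAlgebra ℝ A] [StarRing A] [CStarRing A]
  [StarModule ℝ A] [CompleteSpace A]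

/-- Invertibility excludes `-‖y‖²` from the spectrum of `y*y`, so `‖y‖²` belongs to it; shift by
`t`. -/
theorem add_norm_sq_le_norm_algebraMap_add_star_mul_self [Nontrivial A]
    (hu : ∀ x : A, IsUnit (1 + star x * x)) (y : A) {t : ℝ}(ht : 0 ≤ t) :
    t + ‖y‖ ^ 2 ≤ ‖algebraMap ℝ A t + star y * y‖ := by
  rcases eq_or_ne y 0 with rfl | hy
  · simp [norm_algebraMap', abs_of_nonneg ht]
  have hn : ‖star y * y‖ = ‖y‖ ^ 2 := by rw [CStarRing.norm_star_mul_self, sq]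
  have hy' : 0 < ‖y‖ ^ 2 := by positivity
  rcases (IsSelfAdjoint.star_mul_self y).not_isUnit_sub_norm_or_add_norm hu with h | h
  · have hmem : t + ‖y‖ ^ 2 ∈ spectrum ℝ (algebraMap ℝ A t + star y * y) := by
      rw [spectrum.mem_iff]
      contrapose! h
      rw [hn]
      convert h.neg using 1
      rw [map_add]
      abel
    exact (le_abs_self _).trans (spectrum.norm_le_norm_of_mem hmem)
  · exact absurd (isUnit_add_star_mul_self hu y hy') (by rwa [hn, add_comm] at h)

/-- Otherwise `±‖k‖` in the spectrum of the difference `k` would give `y*y` a spectral value that is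
negative or larger than its norm. This later yields `f (y*y) ≥ 0`. -/
theorem norm_algebraMap_sub_star_mul_self_le [Nontrivial A]
    (hu : ∀ x : A, IsUnit (1 + star x * x))(y : A) :
    ‖algebraMap ℝ A (‖y‖ ^ 2) - star y * y‖ ≤ ‖y‖ ^ 2 := by
  have hn : ‖star y * y‖ = ‖y‖ ^ 2 := by rw [CStarRing.norm_star_mul_self, sq]
  set k := algebraMap ℝ A (‖y‖ ^ 2) - star y * y with hk
  have hsa : IsSelfAdjoint k :=
    (IsSelfAdjoint.algebraMap A (IsSelfAdjoint.all _)).sub (.star_mul_self y)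
  by_contra! hlt
  rcases hsa.not_isUnit_sub_norm_or_add_norm hu with h | h
  · apply h
    convert (isUnit_add_star_mul_self hu y (sub_pos.2 hlt)).neg using 1
    rw [hk, map_sub]
    abel
  · have hmem : ‖y‖ ^ 2 + ‖k‖ ∈ spectrum ℝ (star y * y) := by
      rw [spectrum.mem_iff]
      convert h using 2
      rw [map_add, hk]
      abel
    have h1 := (le_abs_self _).trans (spectrum.norm_le_norm_of_mem hmem)
    have := sq_nonneg ‖y‖
    linarith

end RealCStar

/-! ### From orthogonality to a state -/

section RealCStar

variable {A : Type*} [NormedRing A] [NormedAlgebra ℝ A] [StarRing A] [CStarRing A]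
  [StarModule ℝ A] [CompleteSpace A] [Nontrivial A]

theorem add_mul_norm_sq_le_of_forall_norm_le (hu : ∀ x : A, IsUnit (1 + star x * x)) {a b : A}
    (hab : ∀ r : ℝ, ‖a‖ ≤ ‖a + r • b‖) {s t : ℝ} (hs : 0 ≤ s) (ht : 0 ≤ t) :
    t + s * ‖a‖ ^ 2 ≤ ‖algebraMap ℝ A t + s • (star a * a) + (star a * b + star b * a)‖ := by
  set M := ‖algebraMap ℝ A t + s • (star a * a) + (star a * b + star b * a)‖
  have key : ∀ ε : ℝ, 0 < ε → ε * s ≤ 1 → t + s * ‖a‖ ^ 2 ≤ M + ε * ‖b‖ ^ 2 := fun ε hε hεs => by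
    have h1 := add_norm_sq_le_norm_algebraMap_add_star_mul_self hu (a + ε • b)
      (t := ε * t) (by positivity)
    have hid : algebraMap ℝ A (ε * t) + star (a + ε • b) * (a + ε • b) =
        ε • (algebraMap ℝ A t + s • (star a * a) + (star a * b + star b * a)) +
          (1 - ε * s) • (star a * a) + (ε ^ 2) • (star b * b) := by
      simp only [Algebra.algebraMap_eq_smul_one, star_add, star_smul, star_trivial ε, add_mul,
        mul_add, smul_mul_assoc, mul_smul_comm]
      module
    have h2 : ‖algebraMap ℝ A (ε * t) + star (a + ε • b) * (a + ε • b)‖ ≤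
        ε * M + (1 - ε * s) * ‖a‖ ^ 2 + ε ^ 2 * ‖b‖ ^ 2 := by
      rw [hid]
      refine (norm_add₃_le).trans_eq ?_
      rw [norm_smul, norm_smul, norm_smul, CStarRing.norm_star_mul_self,
        CStarRing.norm_star_mul_self, Real.norm_of_nonneg hε.le,
        Real.norm_of_nonneg (sub_nonneg.2 hεs), Real.norm_of_nonneg (sq_nonneg ε)]
      ring
    have h3 : ‖a‖ ^ 2 ≤ ‖a + ε • b‖ ^ 2 := by gcongr; exact hab ε
    have h4 : ε * (t + s * ‖a‖ ^ 2) ≤ ε * (M + ε * ‖b‖ ^ 2) := by linarith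
    exact le_of_mul_le_mul_left h4 hε
  by_contra! hlt
  set δ := t + s * ‖a‖ ^ 2 - M with hδ
  have hδ0 : 0 < δ := sub_pos.2 hlt
  -- In `ε = δ / D`, the term `(s + 1) * δ` ensures `εs ≤ 1`, and `‖b‖² + 1` contributes to `ε‖b‖² <
  -- δ`.
  have hD : 0 < (s + 1) * δ + ‖b‖ ^ 2 + 1 := by positivity
  have h := key (δ / ((s + 1) * δ + ‖b‖ ^ 2 + 1)) (by positivity) (by
    rw [div_mul_eq_mul_div, div_le_one hD]
    nlinarith [sq_nonneg ‖b‖])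
  have h' : δ / ((s + 1) * δ + ‖b‖ ^ 2 + 1) * ‖b‖ ^ 2 < δ := by
    rw [div_mul_eq_mul_div, div_lt_iff₀ hD]
    have : 0 < δ * ((s + 1) * δ + 1) := by positivity
    nlinarith
  linarith

/-- If `a` is Birkhoff-James orthogonal to `B`, some real functional of norm one at `1` attains
`‖a‖ ^ 2` at `a* a` and kills the selfadjoint parts of `a* b`, for `b` in `B`. -/
theorem exists_linearMap_of_forall_norm_le (hu : ∀ x : A, IsUnit (1 + star x * x)) (a : A)
    (B : Submodule ℝ A) (hB : ∀ b ∈ B, ‖a‖ ≤ ‖a + b‖) :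
    ∃ f : A →ₗ[ℝ] ℝ, f 1 = 1 ∧ (∀ x, f x ≤ ‖x‖) ∧ f (star a * a) = ‖a‖ ^ 2 ∧
      ∀ b ∈ B, f (star a * b + star b * a) = 0 := by
  let F : A → ℝ → ℝ → A → A := fun x s t b =>
    algebraMap ℝ A t + x + s • (star a * a) + (star a * b + star b * a)
  -- Convexity comes from `F` being jointly linear in `(x, s, t, b)`. Each property wanted of `f`
  -- will follow from `f < 0` on `C` for a suitable choice of `s`, `t`, `b`.
  let C : Set A := {x | ∃ s : ℝ, 0 ≤ s ∧ ∃ t : ℝ, 0 ≤ t ∧ ∃ b ∈ B, ‖F x s t b‖ < t + s * ‖a‖ ^ 2}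
  have hCo : IsOpen C := by
    have : C = ⋃ (s : ℝ) (_ : 0 ≤ s) (t : ℝ) (_ : 0 ≤ t) (b ∈ B),
        {x | ‖F x s t b‖ < t + s * ‖a‖ ^ 2} := by
      ext x; simp [C]
    rw [this]
    refine isOpen_iUnion fun s => isOpen_iUnion fun _ => isOpen_iUnion fun t =>
      isOpen_iUnion fun _ => isOpen_iUnion fun b => isOpen_iUnion fun _ =>
      isOpen_lt (by fun_prop) continuous_const
  have hCc : Convex ℝ C := by
    rintro x ⟨s, hs, t, ht, b, hb, hx⟩ y ⟨s', hs', t', ht', b', hb', hy⟩ p q hp hq hpq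
    refine ⟨p * s + q * s', by positivity, p * t + q * t', by positivity, p • b + q • b',
      B.add_mem (B.smul_mem _ hb) (B.smul_mem _ hb'), ?_⟩
    have hid : F (p • x + q • y) (p * s + q * s') (p * t + q * t') (p • b + q • b') =
        p • F x s t b + q • F y s' t' b' := by
      simp only [F, Algebra.algebraMap_eq_smul_one, star_add, star_smul, star_trivial p,
        star_trivial q, add_mul, mul_add, smul_mul_assoc, mul_smul_comm]
      module
    have h1 : ‖p • F x s t b + q • F y s' t' b'‖ ≤ p * ‖F x s t b‖ + q * ‖F y s' t' b'‖ := by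
      refine (norm_add_le _ _).trans_eq ?_
      rw [norm_smul, norm_smul, Real.norm_of_nonneg hp, Real.norm_of_nonneg hq]
    rw [hid]
    refine h1.trans_lt ?_
    rcases hp.eq_or_lt with rfl | hp'
    · obtain rfl : q = 1 := by linarith
      linarith
    · nlinarith [mul_lt_mul_of_pos_left hx hp', mul_le_mul_of_nonneg_left hy.le hq]
  have h0 : (0 : A) ∉ C := by
    rintro ⟨s, hs, t, ht, b, hb, hx⟩
    refine hx.not_ge ?_
    simpa only [F, add_zero] using
      add_mul_norm_sq_le_of_forall_norm_le hu (fun r => hB _ (B.smul_mem r hb)) hs ht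
  obtain ⟨g, hg⟩ := geometric_hahn_banach_open_point hCc hCo h0
  simp only [map_zero] at hg
  have hg1 : 0 < g 1 := by
    have := hg (-1) ⟨0, le_rfl, 2, zero_le_two, 0, B.zero_mem, by
      have : F (-1) 0 2 0 = 1 := by
        simp only [F, Algebra.algebraMap_eq_smul_one, star_zero, mul_zero, zero_mul]
        module
      rw [this, norm_one]; norm_num⟩
    rw [map_neg] at this
    linarith
  let f : A →ₗ[ℝ] ℝ := (g 1)⁻¹ • (g : A →ₗ[ℝ] ℝ)
  have hf1 : f 1 = 1 := by simp [f, hg1.ne']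
  have hfC : ∀ x ∈ C, f x < 0 := fun x hx =>
    mul_neg_of_pos_of_neg (inv_pos.2 hg1) (hg x hx)
  -- The elements of interest only touch the boundary of `C`; subtracting `δ` moves them inside.
  have hfle : ∀ x, (∀ δ : ℝ, 0 < δ → x - algebraMap ℝ A δ ∈ C) → f x ≤ 0 := fun x hx => by
    refine le_of_forall_pos_le_add fun δ hδ => ?_
    have := hfC _ (hx δ hδ)
    rw [map_sub, Algebra.algebraMap_eq_smul_one, map_smul, hf1, smul_eq_mul, mul_one] at this
    linarith
  have hn : ∀ x, f x ≤ ‖x‖ := fun x => by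
    have := hfle (x - algebraMap ℝ A ‖x‖) fun δ hδ => ⟨0, le_rfl, ‖x‖ + δ, by positivity, 0,
      B.zero_mem, by
        have : F (x - algebraMap ℝ A ‖x‖ - algebraMap ℝ A δ) 0 (‖x‖ + δ) 0 = x := by
          simp only [F, Algebra.algebraMap_eq_smul_one, star_zero, mul_zero, zero_mul]
          module
        rw [this]; linarith⟩
    rw [map_sub, Algebra.algebraMap_eq_smul_one, map_smul, hf1, smul_eq_mul, mul_one] at this
    linarith
  have hb : ∀ b ∈ B, f (star a * b + star b * a) ≤ 0 := fun b hb => by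
    refine hfle _ fun δ hδ => ⟨0, le_rfl, δ, hδ.le, -b, B.neg_mem hb, ?_⟩
    have : F (star a * b + star b * a - algebraMap ℝ A δ) 0 δ (-b) = 0 := by
      simp only [F, star_neg, mul_neg, neg_mul]
      module
    rw [this, norm_zero]; linarith
  refine ⟨f, hf1, hn, le_antisymm ?_ ?_, fun b hbB => le_antisymm (hb b hbB) ?_⟩
  · exact (hn _).trans_eq (by rw [CStarRing.norm_star_mul_self, sq])
  · have := hfle (algebraMap ℝ A (‖a‖ ^ 2) - star a * a) fun δ hδ => ⟨1, zero_le_one, δ, hδ.le, 0,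
      B.zero_mem, by
        have : F (algebraMap ℝ A (‖a‖ ^ 2) - star a * a - algebraMap ℝ A δ) 1 δ 0 =
            algebraMap ℝ A (‖a‖ ^ 2) := by
          simp only [F, Algebra.algebraMap_eq_smul_one, star_zero, mul_zero, zero_mul]
          module
        rw [this, norm_algebraMap', Real.norm_of_nonneg (by positivity)]; linarith⟩
    rw [map_sub, Algebra.algebraMap_eq_smul_one, map_smul, hf1, smul_eq_mul, mul_one] at this
    linarith
  · have := hb (-b) (B.neg_mem hbB)
    rw [star_neg, mul_neg, neg_mul, ← neg_add, map_neg] at this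
    linarith

end RealCStar

/-- A subspace to which `a` is Birkhoff-James orthogonal is annihilated by `φ (a* ·)` for a state `φ`
attaining `‖a‖ ^ 2` at `a* a`. -/
theorem IsBJOrthogonalTo.exists_isState {𝕜 A : Type*} [RCLike 𝕜] [NormedRing A] [StarRing A]
    [CompleteSpace A] [CStarRing A] [NormedAlgebra 𝕜 A] [StarModule 𝕜 A]
    [IsUnitalCStarAlgebra 𝕜 A] [Nontrivial A] {a : A} {B : Submodule 𝕜 A}
    (h : IsBJOrthogonalTo a B) :
    ∃ φ : A →ₗ[𝕜] 𝕜, IsState φ ∧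
      φ (star a * a) = ((‖a‖ ^ 2 : ℝ) : 𝕜) ∧ ∀ b ∈ B, φ (star a * b) = 0 := by
  let _ : NormedAlgebra ℝ A := NormedAlgebra.restrictScalars ℝ 𝕜 A
  have : IsScalarTower ℝ 𝕜 A := IsScalarTower.of_algebraMap_smul fun _ _ => rfl
  have : StarModule ℝ A := ⟨fun r x => by
    rw [← algebraMap_smul 𝕜 r x, ← algebraMap_smul 𝕜 (star r) (star x), star_smul]
    simp⟩
  have hu := IsUnitalCStarAlgebra.isUnit 𝕜 (A := A)
  obtain ⟨f, hf1, hfn, hfa, hfb⟩ := exists_linearMap_of_forall_norm_le hu a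
    (B.restrictScalars ℝ) fun b hb => by simpa using h b hb 1
  -- Symmetrising makes `ψ` vanish on `I • x` for selfadjoint `x`, so the extension `ψ x - I ψ (I
  -- x)` is real there.
  let ψ : Module.Dual ℝ A :=
    { toFun := fun x => 2⁻¹ * f (x + star x)
      map_add' := fun x y => by
        rw [star_add, add_add_add_comm, map_add]; ring
      map_smul' := fun r x => by
        rw [star_smul, star_trivial r, ← smul_add, map_smul]
        simp only [smul_eq_mul, RingHom.id_apply]; ring }
  have hψ : ∀ x, ψ x = 2⁻¹ * f (x + star x) := fun _ => rfl
  have hψsa : ∀ x, star x = x → ψ x = f x := fun x hx => by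
    rw [hψ, hx, map_add]; ring
  have hψI : ∀ x, star x = x → ψ ((RCLike.I : 𝕜) • x) = 0 := fun x hx => by
    rw [hψ, star_smul, hx, RCLike.star_def, RCLike.conj_I, neg_smul, add_neg_cancel, map_zero,
      mul_zero]
  have hφsa : ∀ x, star x = x → (ψ.extendRCLike : A →ₗ[𝕜] 𝕜) x = (f x : 𝕜) := fun x hx => by
    rw [Module.Dual.extendRCLike_apply, hψsa x hx, hψI x hx]; simp
  have hsa : ∀ y : A, star (star y * y) = star y * y := fun y => by simp
  refine ⟨ψ.extendRCLike, ⟨?_, ?_, ?_⟩, ?_, ?_⟩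
  · rw [hφsa 1 (star_one A), hf1, RCLike.ofReal_one]
  · rintro _ ⟨y, rfl⟩
    refine ⟨f (star y * y), ?_, hφsa _ (hsa y)⟩
    have h1 := (hfn _).trans (norm_algebraMap_sub_star_mul_self_le hu y)
    rw [map_sub, Algebra.algebraMap_eq_smul_one, map_smul, hf1, smul_eq_mul, mul_one] at h1
    linarith
  · intro hI x
    have hx : ψ (star x) = ψ x := by rw [hψ, hψ, star_star, add_comm]
    rw [Module.Dual.extendRCLike_apply, Module.Dual.extendRCLike_apply, hI, hx]
    simp
  · rw [hφsa _ (hsa a), hfa]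
  · intro b hb
    have hb0 : ∀ b ∈ B, ψ (star a * b) = 0 := fun b hb => by
      rw [hψ, star_mul, star_star, hfb b hb, mul_zero]
    -- `B` is a `𝕜`-subspace, so both `b` and `I • b` are available.
    rw [Module.Dual.extendRCLike_apply, hb0 b hb, ← mul_smul_comm, hb0 _ (B.smul_mem _ hb)]
    simp

/-! ### Square roots, contractivity of representations and Pythagoras -/

section RealCStar

variable {A : Type*} [NormedRing A] [NormedAlgebra ℝ A] [StarRing A] [NormedStarGroup A]
  [StarModule ℝ A] [CompleteSpace A]

/-- With `k = 1 - u` the equation becomes `u = (h + u²) / 2`, whose right side is a contraction of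
ratio `‖h‖` on the selfadjoint elements of norm at most `‖h‖`. -/
theorem IsSelfAdjoint.exists_mul_self_eq_one_sub {h : A} (hh : IsSelfAdjoint h) (h1 : ‖h‖ < 1) :
    ∃ k : A, IsSelfAdjoint k ∧ k * k = 1 - h := by
  let c : NNReal := ‖h‖₊
  let f : A → A := fun u => (2⁻¹ : ℝ) • (h + u * u)
  let s : Set A := {u | ‖u‖ ≤ ‖h‖ ∧ star u = u}
  have hs : IsComplete s := IsClosed.isComplete <|
    (isClosed_le continuous_norm continuous_const).inter
      (isClosed_eq continuous_star continuous_id)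
  have hmaps : Set.MapsTo f s s := by
    rintro u ⟨hu, hus⟩
    refine ⟨?_, ?_⟩
    · have h2 : ‖u * u‖ ≤ ‖h‖ * ‖h‖ := (norm_mul_le _ _).trans (by gcongr)
      have h3 := norm_add_le h (u * u)
      have h4 : ‖h‖ * ‖h‖ ≤ ‖h‖ := mul_le_of_le_one_right (norm_nonneg _) h1.le
      rw [norm_smul, norm_inv, Real.norm_two]
      linarith
    · simp only [f]
      rw [star_smul, star_trivial (2⁻¹ : ℝ), star_add, hh.star_eq, star_mul, hus]
  have hcontr : ContractingWith c (hmaps.restrict f s s) := by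
    refine ⟨h1, LipschitzWith.of_dist_le_mul ?_⟩
    rintro ⟨u, hu, -⟩ ⟨v, hv, -⟩
    change dist (f u) (f v) ≤ ‖h‖ * dist u v
    have hid : f u - f v = (2⁻¹ : ℝ) • (u * (u - v) + (u - v) * v) := by
      simp only [f, mul_sub, sub_mul]
      module
    rw [dist_eq_norm, dist_eq_norm, hid, norm_smul, norm_inv, Real.norm_two]
    have h2 : ‖u * (u - v)‖ ≤ ‖h‖ * ‖u - v‖ := (norm_mul_le _ _).trans (by gcongr)
    have h3 : ‖(u - v) * v‖ ≤ ‖u - v‖ * ‖h‖ := (norm_mul_le _ _).trans (by gcongr)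
    have h4 := norm_add_le (u * (u - v)) ((u - v) * v)
    linarith
  obtain ⟨u, hus, hfu, -⟩ := hcontr.exists_fixedPoint' hs hmaps
    (x := 0) ⟨by simp, star_zero A⟩ (edist_ne_top _ _)
  refine ⟨1 - u, ?_, ?_⟩
  · rw [IsSelfAdjoint, star_sub, star_one, hus.2]
  · have h2 : (2 : ℝ) • u = h + u * u := by
      conv_lhs => rw [← hfu.eq]
      simp [f]
    have h3 : h = (2 : ℝ) • u - u * u := by rw [h2]; abel
    rw [h3, mul_sub, sub_mul, sub_mul, mul_one, mul_one, one_mul, two_smul]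
    abel

end RealCStar

section

variable {A : Type*} [NormedRing A] [NormedAlgebra ℝ A] [StarRing A] [CStarRing A]
  [StarModule ℝ A] [CompleteSpace A]

theorem LinearMap.map_star_mul_self_le_of_nonneg (g : A →ₗ[ℝ] ℝ) (hg : ∀ k, 0 ≤ g (star k * k))
    (x : A) : g (star x * x) ≤ ‖x‖ ^ 2 * g 1 := by
  -- For such `s`, `1 - s⁻¹ x*x` is a square `k*k`, on which `g` is nonnegative.
  have key : ∀ s : ℝ, ‖x‖ ^ 2 < s → g (star x * x) ≤ s * g 1 := fun s hs => by
    have hs0 : 0 < s := (sq_nonneg _).trans_lt hs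
    obtain ⟨k, hk, hkk⟩ := IsSelfAdjoint.exists_mul_self_eq_one_sub (h := s⁻¹ • (star x * x))
      ((IsSelfAdjoint.all _).smul (.star_mul_self x)) (by
        rw [norm_smul, CStarRing.norm_star_mul_self, norm_inv, Real.norm_of_nonneg hs0.le, ← sq,
          inv_mul_lt_one₀ hs0]
        exact hs)
    have h1 := hg k
    rw [hk.star_eq, hkk, map_sub, map_smul, smul_eq_mul, sub_nonneg, inv_mul_le_iff₀ hs0] at h1
    exact h1
  refine ge_of_tendsto (f := fun s : ℝ => s * g 1) (x := nhdsWithin (‖x‖ ^ 2) (Set.Ioi (‖x‖ ^ 2)))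
    ?_ (eventually_nhdsWithin_of_forall key)
  exact ((continuous_id.mul continuous_const).tendsto _).mono_left nhdsWithin_le_nhds

end

section

variable {𝕜 : Type v} {A : Type u} [RCLike 𝕜] [NormedRing A] [StarRing A]
  [CompleteSpace A] [CStarRing A] [NormedAlgebra 𝕜 A] [StarModule 𝕜 A]

theorem re_map_star_mul_self_le_of_nonneg (g : A →ₗ[𝕜] 𝕜)
    (hg : ∀ k, 0 ≤ RCLike.re (g (star k * k))) (x : A) :
    RCLike.re (g (star x * x)) ≤ ‖x‖ ^ 2 * RCLike.re (g 1) := by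
  let _ : NormedAlgebra ℝ A := NormedAlgebra.restrictScalars ℝ 𝕜 A
  have : IsScalarTower ℝ 𝕜 A := IsScalarTower.of_algebraMap_smul fun _ _ => rfl
  have : StarModule ℝ A := ⟨fun r x => by
    rw [← algebraMap_smul 𝕜 r x, ← algebraMap_smul 𝕜 (star r) (star x), star_smul]
    simp⟩
  exact (RCLike.reLm.comp (g.restrictScalars ℝ)).map_star_mul_self_le_of_nonneg hg x

/-- Apply the bound for positive functionals to the vector functional `z ↦ ⟪η, π z η⟫`; no
continuity of `π` is assumed. -/
theorem StarAlgHom.norm_apply_apply_le {H : Type*} [NormedAddCommGroup H] [InnerProductSpace 𝕜 H]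
    [CompleteSpace H] (π : A →⋆ₐ[𝕜] (H →L[𝕜] H)) (x : A) (η : H) : ‖π x η‖ ≤ ‖x‖ * ‖η‖ := by
  let g : A →ₗ[𝕜] 𝕜 :=
    { toFun := fun z => inner 𝕜 η (π z η)
      map_add' := fun y z => by simp [inner_add_right]
      map_smul' := fun c z => by simp [inner_smul_right] }
  have hg : ∀ z, g (star z * z) = inner 𝕜 (π z η) (π z η) := fun z => by
    change inner 𝕜 η (π (star z * z) η) = _
    rw [map_mul, map_star, ContinuousLinearMap.star_eq_adjoint, mul_apply_eq_comp,
      ContinuousLinearMap.adjoint_inner_right]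
  have h := re_map_star_mul_self_le_of_nonneg g (fun k => by
    rw [hg]; exact inner_self_nonneg) x
  have hg1 : g 1 = inner 𝕜 η η := by
    change inner 𝕜 η (π 1 η) = _
    simp
  rw [hg, hg1, inner_self_eq_norm_sq, inner_self_eq_norm_sq, ← mul_pow] at h
  exact (sq_le_sq₀ (norm_nonneg _) (by positivity)).1 h

theorem IsCyclicRepresentation.isBJOrthogonalTo {H : Type*} [NormedAddCommGroup H]
    [InnerProductSpace 𝕜 H] [CompleteSpace H] {π : A →⋆ₐ[𝕜] (H →L[𝕜] H)} {ξ : H}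
    (h : IsCyclicRepresentation π ξ) {a : A} {B : Submodule 𝕜 A} (ha : ‖π a ξ‖ = ‖a‖)
    (hB : ∀ b ∈ B, inner 𝕜 (π a ξ) (π b ξ) = 0) : IsBJOrthogonalTo a B := by
  intro b hb k
  have h1 := π.norm_apply_apply_le (a + k • b) ξ
  rw [h.norm_eq_one, mul_one] at h1
  refine le_trans ?_ h1
  have h2 : π (a + k • b) ξ = π a ξ + π (k • b) ξ := by rw [map_add]; rfl
  have h3 := norm_add_sq_eq_norm_sq_add_norm_sq_of_inner_eq_zero (π a ξ) (π (k • b) ξ)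
    (hB _ (B.smul_mem k hb))
  rw [← ha, h2]
  nlinarith [norm_nonneg (π a ξ), norm_nonneg (π a ξ + π (k • b) ξ), norm_nonneg (π (k • b) ξ)]

end

/-! ### The Gelfand-Naimark-Segal construction -/

namespace IsState

variable {𝕜 : Type v} {A : Type u} [RCLike 𝕜] [NormedRing A] [StarRing A] [NormedAlgebra 𝕜 A]

/-- The pre-Hilbert space of the Gelfand-Naimark-Segal construction: `A` with the form
`⟪x, y⟫ = φ (x* y)`. -/
def PreGNS {φ : A →ₗ[𝕜] 𝕜} (_ : IsState φ) : Type u := A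

variable {φ : A →ₗ[𝕜] 𝕜} (hφ : IsState φ)

instance : AddCommGroup hφ.PreGNS := inferInstanceAs (AddCommGroup A)
instance : Module 𝕜 hφ.PreGNS := inferInstanceAs (Module 𝕜 A)

/-- The identity map onto the pre-Hilbert space of a state. -/
def toPreGNS : A ≃ₗ[𝕜] hφ.PreGNS := LinearEquiv.refl 𝕜 _

/-- The identity map from the pre-Hilbert space of a state. -/
def ofPreGNS : hφ.PreGNS ≃ₗ[𝕜] A := hφ.toPreGNS.symm

@[simp] theorem toPreGNS_ofPreGNS (x : hφ.PreGNS) : hφ.toPreGNS (hφ.ofPreGNS x) = x := rfl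

@[simp] theorem ofPreGNS_toPreGNS (x : A) : hφ.ofPreGNS (hφ.toPreGNS x) = x := rfl

theorem re_map_star_mul_self_nonneg (hφ : IsState φ) (x : A) :
    0 ≤ RCLike.re (φ (star x * x)) := by
  obtain ⟨r, hr, h⟩ := hφ.map_nonneg _ ⟨x, rfl⟩
  rwa [h, RCLike.ofReal_re]

variable [StarModule 𝕜 A]

theorem map_star (hφ : IsState φ) (x : A) :
    φ (star x) = starRingEnd 𝕜 (φ x) := by
  rcases RCLike.I_eq_zero_or_im_I_eq_one (K := 𝕜) with hI | hI
  · rw [hφ.map_star_of_real hI, eq_comm, RCLike.conj_eq_iff_im, RCLike.im_eq_zero hI]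
  · have him : ∀ y, RCLike.im (φ (star y * y)) = 0 := fun y => by
      obtain ⟨r, -, hr⟩ := hφ.map_nonneg _ ⟨y, rfl⟩
      rw [hr, RCLike.ofReal_im]
    -- Polarisation: the two expansions isolate the imaginary and the real part of the claim.
    have h1 := him (1 + x)
    have h2 := him (1 + (RCLike.I : 𝕜) • x)
    have hx := him x
    simp only [star_add, star_one, star_smul, add_mul, mul_add, one_mul, mul_one, smul_mul_assoc,
      mul_smul_comm, map_add, map_smul, hφ.map_one, hx, smul_eq_mul, RCLike.star_def,
      RCLike.conj_I, RCLike.one_im] at h1 h2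
    have hI2 : (RCLike.I : 𝕜) * RCLike.I = -1 := RCLike.I_mul_I_of_nonzero fun h => by simp [h] at hI
    simp only [RCLike.mul_im, RCLike.mul_re, map_neg, RCLike.I_re, hI, hx] at h2
    apply RCLike.ext
    · rw [RCLike.conj_re]; simp at h2; linarith
    · rw [RCLike.conj_im]; linarith

/-- The positive semidefinite form of a state. -/
noncomputable abbrev preGNSCore : PreInnerProductSpace.Core 𝕜 hφ.PreGNS where
  inner x y := φ (star (hφ.ofPreGNS x) * hφ.ofPreGNS y)
  conj_inner_symm x y := by rw [← hφ.map_star]; simp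
  re_inner_nonneg x := hφ.re_map_star_mul_self_nonneg _
  add_left _ _ _ := by rw [map_add, star_add, add_mul, map_add]
  smul_left := by simp

noncomputable instance : SeminormedAddCommGroup hφ.PreGNS :=
  InnerProductSpace.Core.toSeminormedAddCommGroup (c := hφ.preGNSCore)

noncomputable instance : InnerProductSpace 𝕜 hφ.PreGNS :=
  InnerProductSpace.ofCore hφ.preGNSCore

theorem preGNS_inner_def (x y : hφ.PreGNS) :
    inner 𝕜 x y = φ (star (hφ.ofPreGNS x) * hφ.ofPreGNS y) := rfl

theorem preGNS_norm_sq (x : hφ.PreGNS) :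
    ‖x‖ ^ 2 = RCLike.re (φ (star (hφ.ofPreGNS x) * hφ.ofPreGNS x)) := by
  rw [← hφ.preGNS_inner_def, inner_self_eq_norm_sq]

/-- The Hilbert space of the Gelfand-Naimark-Segal construction. -/
abbrev GNS : Type u := UniformSpace.Completion hφ.PreGNS

variable [CompleteSpace A] [CStarRing A]

/-- Left multiplication on the pre-Hilbert space of a state. -/
noncomputable def leftMulPreGNS (a : A) : hφ.PreGNS →L[𝕜] hφ.PreGNS :=
  (hφ.toPreGNS.toLinearMap ∘ₗ LinearMap.mul 𝕜 A a ∘ₗ hφ.ofPreGNS.toLinearMap).mkContinuous ‖a‖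
    fun x => by
      set y := hφ.ofPreGNS x
      -- `g z = φ (y* z y)` is again positive, with `g 1 = φ (y*y)`, so the bound on `g (a*a)` is
      -- the boundedness of left multiplication.
      let g : A →ₗ[𝕜] 𝕜 := φ ∘ₗ LinearMap.mulLeft 𝕜 (star y) ∘ₗ LinearMap.mulRight 𝕜 y
      have h := re_map_star_mul_self_le_of_nonneg g (fun k => by
        have := hφ.re_map_star_mul_self_nonneg (k * y)
        simpa [g, mul_assoc] using this) a
      rw [← sq_le_sq₀ (by positivity) (by positivity), mul_pow, preGNS_norm_sq, preGNS_norm_sq]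
      simpa [g, mul_assoc] using h

@[simp]
theorem leftMulPreGNS_apply (a : A) (x : hφ.PreGNS) :
    hφ.leftMulPreGNS a x = hφ.toPreGNS (a * hφ.ofPreGNS x) := rfl

open UniformSpace Completion in
/-- The Gelfand-Naimark-Segal representation of a state. -/
noncomputable def gnsStarAlgHom : A →⋆ₐ[𝕜] (hφ.GNS →L[𝕜] hφ.GNS) where
  toFun a := (hφ.leftMulPreGNS a).completion
  map_zero' := by
    ext c
    induction c using induction_on with
    | hp => apply isClosed_eq <;> fun_prop
    | ih c => simp [Completion.coe_zero]
  map_add' _ _ := by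
    ext c
    induction c using induction_on with
    | hp => apply isClosed_eq <;> fun_prop
    | ih c => simp [add_mul, Completion.coe_add]
  map_one' := by
    ext c
    induction c using induction_on with
    | hp => apply isClosed_eq <;> fun_prop
    | ih c => simp
  map_mul' _ _ := by
    ext c
    induction c using induction_on with
    | hp => apply isClosed_eq <;> fun_prop
    | ih c => simp [mul_assoc]
  commutes' r := by
    ext c
    induction c using induction_on with
    | hp => apply isClosed_eq <;> fun_prop
    | ih c => simp [Algebra.algebraMap_eq_smul_one]
  map_star' a := by
    refine (ContinuousLinearMap.eq_adjoint_iff (hφ.leftMulPreGNS (star a)).completion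
      (hφ.leftMulPreGNS a).completion).mpr fun x y => ?_
    induction x, y using induction_on₂ with
    | hp => apply isClosed_eq <;> fun_prop
    | ih x y => simp [mul_assoc, preGNS_inner_def]

theorem gnsStarAlgHom_apply_coe (a : A) (x : hφ.PreGNS) :
    hφ.gnsStarAlgHom a (x : hφ.GNS) = (hφ.toPreGNS (a * hφ.ofPreGNS x) : hφ.PreGNS) :=
  (hφ.leftMulPreGNS a).completion_apply_coe x

theorem isCyclicRepresentation_gnsStarAlgHom :
    IsCyclicRepresentation hφ.gnsStarAlgHom (hφ.toPreGNS 1 : hφ.GNS) where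
  norm_eq_one := by
    rw [UniformSpace.Completion.norm_coe, ← sq_eq_sq₀ (norm_nonneg _) zero_le_one, preGNS_norm_sq]
    simp [hφ.map_one]
  dense_orbit := by
    refine UniformSpace.Completion.denseRange_coe.mono ?_
    rintro _ ⟨x, rfl⟩
    exact ⟨hφ.ofPreGNS x, by rw [gnsStarAlgHom_apply_coe]; simp⟩

theorem inner_gnsStarAlgHom_apply (a b : A) :
    inner 𝕜 (hφ.gnsStarAlgHom a (hφ.toPreGNS 1 : hφ.GNS))
      (hφ.gnsStarAlgHom b (hφ.toPreGNS 1 : hφ.GNS)) = φ (star a * b) := by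
  rw [gnsStarAlgHom_apply_coe, gnsStarAlgHom_apply_coe, UniformSpace.Completion.inner_coe,
    preGNS_inner_def]
  simp

end IsState

theorem mainTheorem1 {𝕜 : Type v} [RCLike 𝕜] {A : Type u} [NormedRing A] [StarRing A]
    [CompleteSpace A] [CStarRing A] [NormedAlgebra 𝕜 A] [StarModule 𝕜 A]
    [IsUnitalCStarAlgebra 𝕜 A] [Nontrivial A]
    (a : A) (B : Submodule 𝕜 A) :
    List.TFAE [
      IsBJOrthogonalTo a B,
      ∃ φ : A →ₗ[𝕜] 𝕜, IsState φ ∧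
        φ (star a * a) = ((‖a‖ ^ 2 : ℝ) : 𝕜) ∧ ∀ b ∈ B, φ (star a * b) = 0,
      ∃ (H : Type u) (_ : NormedAddCommGroup H) (_ : InnerProductSpace 𝕜 H) (_ : CompleteSpace H)
        (π : A →⋆ₐ[𝕜] (H →L[𝕜] H)) (ξ : H), IsCyclicRepresentation π ξ ∧
        ‖π a ξ‖ = ‖a‖ ∧ ∀ b ∈ B, inner 𝕜 (π a ξ) (π b ξ) = 0] := by
  tfae_have 1 → 2 := fun h => h.exists_isState
  tfae_have 2 → 3 := by
    rintro ⟨φ, hφ, ha, hB⟩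
    refine ⟨hφ.GNS, inferInstance, inferInstance, inferInstance, hφ.gnsStarAlgHom,
      (hφ.toPreGNS 1 : hφ.PreGNS), hφ.isCyclicRepresentation_gnsStarAlgHom, ?_, fun b hb => ?_⟩
    · rw [← sq_eq_sq₀ (norm_nonneg _) (norm_nonneg _), ← inner_self_eq_norm_sq (𝕜 := 𝕜),
        IsState.inner_gnsStarAlgHom_apply, ha, RCLike.ofReal_re]
    · rw [IsState.inner_gnsStarAlgHom_apply, hB b hb]
  tfae_have 3 → 1 := by
    rintro ⟨H, _, _, _, π, ξ, h, ha, hB⟩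
    exact h.isBJOrthogonalTo ha hB
  tfae_finish
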